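/- **Setting.** Let $\mathbf z=(z_1,\dots,z_N)$ take values in an open, simply connected product $\mathcal Z=\mathcal Z_1\times\dots\times\mathcal Z_N\subseteq\mathbb R^N$ and have a density $p$ that is smooth on $\mathcal Z$ and positive almost everywhere on $\mathcal Z$. For $A\subseteq[N]$ let $\mathbf z_A=(z_j)_{j\in A}$ and $\mathcal Z_A=\prod_{j\in A}\mathcal Z_j$. One observes views $\mathbf x_k=f_k(\mathbf z_{S_k})$, $k=1,\dots,K$, where $S_k\subseteq[N]$ and $f_k$ is a diffeomorphism of $\mathcal Z_{S_k}$ onto $\mathcal X_k\subseteq\mathbb R^{d_k}$. A function $g$ of the views with values in $\mathbb R^{A}$ *block-identifies* $\mathbf z_A$ (with set of values $W\subseteq\mathbb R^A$) if there is a diffeomorphism $h$ of $\mathcal Z_A$ onto $W$ such that $g(\mathbf x)=h(\mathbf z_A)$ for all $\mathbf z\in\mathcal Z$. **Corollary (Identifiability Algebra: Union).** Let $C_1,C_2\subseteq[N]$, and let encoders $g_1$ of a view $\mathbf x_{k_1}$ and $g_2$ of a view $\mathbf x_{k_2}$ block-identify $\mathbf z_{C_1}$ and $\mathbf z_{C_2}$,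 with sets of values $W_1$ and $W_2$. Suppose that $\mathbf z_{C_1\cap C_2}$, $\mathbf z_{C_1\setminus C_2}$ and $\mathbf z_{C_2\setminus C_1}$ are mutually independent. Then the union $\mathbf z_{C_1\cup C_2}$ can be block-identified from the pair of representations $\hat{\mathbf c}=(g_1(\mathbf x_{k_1}),g_2(\mathbf x_{k_2}))$, by concatenating the identified intersection block and the two complement blocks. Precisely: 1. There are functions $a,b,c$, smooth on $W_1\times W_2$, such that $a(\hat{\mathbf c})$, $b(\hat{\mathbf c})$, $c(\hat{\mathbf c})$ block-identify $\mathbf z_{C_1\cap C_2}$, $\mathbf z_{C_1\setminus C_2}$, $\mathbf z_{C_2\setminus C_1}$ with sets of values $\mathcal Z_{C_1\cap C_2}$, $\mathcal Z_{C_1\setminus C_2}$, $\mathcal Z_{C_2\setminus C_1}$, and their concatenation $[a(\hat{\mathbf c}),b(\hat{\mathbf c}),c(\hat{\mathbf c})]$ block-identifies $\mathbf z_{C_1\cup C_2}$ with set of values $\mathcal Z_{C_1\cup C_2}$. 2. Whenever $a(\hat{\mathbf c})$, $b(\hat{\mathbf c})$, $c(\hat{\mathbf c})$ block-identify these three blocks,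 with any sets of values, the concatenation $[a(\hat{\mathbf c}),b(\hat{\mathbf c}),c(\hat{\mathbf c})]$ block-identifies $\mathbf z_{C_1\cup C_2}$. Moreover, this depends only on the distribution of $\hat{\mathbf c}$: for every other such model with $N$ latent variables (with any latent space, density, views and mixing functions) and every pair $\hat{\mathbf c}'$ of encoders of two of its views that satisfy the same hypotheses with the same $C_1,C_2,W_1,W_2$, if $\hat{\mathbf c}'$ and $\hat{\mathbf c}$ have the same distribution, then in that model too $[a(\hat{\mathbf c}'),b(\hat{\mathbf c}'),c(\hat{\mathbf c}')]$ block-identifies the union $\mathbf z_{C_1\cup C_2}$, and $a(\hat{\mathbf c}')$ block-identifies the intersection $\mathbf z_{C_1\cap C_2}$. -/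

import Mathlib

open scoped ContDiff

/-- The block `z_A` of the coordinates of `z` with index in `A`. -/
def subvec {N : ℕ} (A : Finset (Fin N)) (z : Fin N → ℝ) : A → ℝ := fun j => z j

/-- `f` restricts to a diffeomorphism of the set `s` onto the set `t`: it maps `s` into `t`, is
smooth on `s`, and has a two-sided inverse that is smooth on `t`. -/
def IsDiffeoOnto {E F : Type*} [NormedAddCommGroup E] [NormedSpace ℝ E]
    [NormedAddCommGroup F] [NormedSpace ℝ F] (f : E → F) (s : Set E) (t : Set F) : Prop :=
  ContDiffOn ℝ ∞ f s ∧ Set.MapsTo f s t ∧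
    ∃ f' : F → E, ContDiffOn ℝ ∞ f' t ∧ Set.MapsTo f' t s ∧
      Set.LeftInvOn f' f s ∧ Set.RightInvOn f' f t

/-- A latent variable model with `N` real latent variables and `K` views, the `k`-th one with
values in `ℝ^(d k)`. -/
structure MultiViewModel (N K : ℕ) (d : Fin K → ℕ) where
  /-- the range of the `j`-th latent variable -/
  range : Fin N → Set ℝ
  /-- the latent space, the product of the ranges, is open and simply connected -/
  isOpen_latent : IsOpen (Set.univ.pi range)
  simplyConnected_latent : SimplyConnectedSpace (Set.univ.pi range)
  /-- the density of the latent variables on the latent space -/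
  density : (Fin N → ℝ) → ℝ
  density_smooth : ContDiffOn ℝ ∞ density (Set.univ.pi range)
  density_pos : ∀ᵐ z ∂(MeasureTheory.volume.restrict (Set.univ.pi range)), 0 < density z
  density_total : ∫⁻ z in Set.univ.pi range, ENNReal.ofReal (density z) = 1
  /-- the latent variables on which the `k`-th view depends -/
  support : Fin K → Finset (Fin N)
  /-- the observation space of the `k`-th view -/
  obs : (k : Fin K) → Set (Fin (d k) → ℝ)
  /-- the mixing function of the `k`-th view, a diffeomorphism onto the observation space -/
  mix : (k : Fin K) → (support k → ℝ) → (Fin (d k) → ℝ)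
  mix_diffeo : ∀ k, IsDiffeoOnto (mix k) {u | ∀ j : support k, u j ∈ range j} (obs k)

namespace MultiViewModel

variable {N K : ℕ} {d : Fin K → ℕ}

/-- The latent space. -/
def latent (M : MultiViewModel N K d) : Set (Fin N → ℝ) := Set.univ.pi M.range

/-- The space of values of the block with index set `A`. -/
def latentBlock (M : MultiViewModel N K d) (A : Finset (Fin N)) : Set (A → ℝ) :=
  {u | ∀ j : A, u j ∈ M.range j}

/-- The law of the latent variables. -/
noncomputable def law (M : MultiViewModel N K d) : MeasureTheory.Measure (Fin N → ℝ) :=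
  (MeasureTheory.volume.restrict M.latent).withDensity fun z => ENNReal.ofReal (M.density z)

/-- All the views that are generated by the latent vector `z`. -/
def views (M : MultiViewModel N K d) (z : Fin N → ℝ) : (k : Fin K) → Fin (d k) → ℝ :=
  fun k => M.mix k (subvec (M.support k) z)

/-- The function `g` of the views block-identifies the block `z_A` with set of values `W`: one has
`g x = h z_A` for a diffeomorphism `h` of the space of values of `z_A` onto `W`. -/
def BlockIdentifiesOnto (M : MultiViewModel N K d) (A : Finset (Fin N)) (W : Set (A → ℝ))
    (g : ((k : Fin K) → Fin (d k) → ℝ) → (A → ℝ)) : Prop :=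
  ∃ h : (A → ℝ) → (A → ℝ), IsDiffeoOnto h (M.latentBlock A) W ∧
    ∀ z ∈ M.latent, g (M.views z) = h (subvec A z)

/-- The function `g` of the views block-identifies the block `z_A`. -/
def BlockIdentifies (M : MultiViewModel N K d) (A : Finset (Fin N))
    (g : ((k : Fin K) → Fin (d k) → ℝ) → (A → ℝ)) : Prop :=
  ∃ W : Set (A → ℝ), M.BlockIdentifiesOnto A W g

/-- The intersection of two blocks and their two set differences are mutually independent. -/
def PartsIndependent (M : MultiViewModel N K d) (A B : Finset (Fin N)) : Prop :=
  ProbabilityTheory.iIndepFun (fun i : Fin 3 => subvec (![A ∩ B, A \ B, B \ A] i)) M.law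

end MultiViewModel

/-- A pair of representations of the views `k₁` and `k₂`, computed by two encoders. -/
def encodePair {K : ℕ} {d : Fin K → ℕ} {α β : Type*} (k₁ k₂ : Fin K)
    (g₁ : (Fin (d k₁) → ℝ) → α) (g₂ : (Fin (d k₂) → ℝ) → β)
    (x : (k : Fin K) → Fin (d k) → ℝ) : α × β :=
  (g₁ (x k₁), g₂ (x k₂))

/-- Concatenation of vectors indexed by `A ∩ B`, `A \ B` and `B \ A`, as a vector indexed by
`A ∪ B`. -/
def concat₃ {N : ℕ} {A B : Finset (Fin N)} (a : ↥(A ∩ B) → ℝ) (b : ↥(A \ B) → ℝ)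
    (c : ↥(B \ A) → ℝ) : ↥(A ∪ B) → ℝ := fun j =>
  if hA : (j : Fin N) ∈ A then
    if hB : (j : Fin N) ∈ B then a ⟨j, Finset.mem_inter.2 ⟨hA, hB⟩⟩
    else b ⟨j, Finset.mem_sdiff.2 ⟨hA, hB⟩⟩
  else c ⟨j, Finset.mem_sdiff.2 ⟨(Finset.mem_union.1 j.2).resolve_left hA, hA⟩⟩

open MeasureTheory

/-! ### Restricting, gluing and concatenating blocks of coordinates. -/

section Blocks

variable {N : ℕ}

/-! Within one model, the inverse diffeomorphisms `e₁`, `e₂` of the two identifications recover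
`z_A` and `z_B` from the representations, and restricting coordinates gives the three parts.

To pass to a model `M'` with the same law of the pair, compare latents through the transition maps
`φ = e₁ ∘ h₁'` and `χ = e₂ ∘ h₂'` from the blocks of `M'` to those of `M`. In `M` the pair satisfies
an equation: `e₁` of the first entry and `e₂` of the second agree on `A ∩ B`. By continuity the
equation fails on a relatively open set, and every nonempty open subset of the latent space of `M'`
has positive mass, so equality of laws carries the equation to every latent point of `M'`
(`eqOn_of_map_law_eq`). Hence `φ` and `χ` agree on the common coordinates and glue to a map `Φ` of
the union blocks. The same argument in the other direction gives its inverse, so `Φ` is a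
diffeomorphism.

The pair at `z'` equals the pair at any `z` with `z_{A ∪ B} = Φ z'_{A ∪ B}`, so a concatenation that
identifies the union in `M` identifies it in `M'` after composition with `Φ`. The `A ∩ B` part of
`Φ` can be read from `φ` or from `χ`, so it depends neither on `B \ A` nor on `A \ B`, and `Φ`
descends to a diffeomorphism of the intersection block. The argument gives no such descent for `A \
B` and `B \ A`, since `φ` and `χ` may mix in the coordinates of `A ∩ B`. -/

theorem contDiff_restrict₂ {A B : Finset (Fin N)} (h : A ⊆ B) :
    ContDiff ℝ ∞ (Finset.restrict₂ (π := fun _ => ℝ) h) :=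
  contDiff_pi.2 fun j => contDiff_apply ℝ ℝ (⟨j, h j.2⟩ : B)

theorem contDiff_subvec (A : Finset (Fin N)) : ContDiff ℝ ∞ (subvec A) :=
  contDiff_pi.2 fun j => contDiff_apply ℝ ℝ (j : Fin N)

/-- A vector indexed by `A ∪ B` is determined by its restrictions to `A` and to `B`. -/
theorem eq_of_restrict₂_union_eq {A B : Finset (Fin N)} {u v : ↥(A ∪ B) → ℝ}
    (hA : Finset.restrict₂ (π := fun _ => ℝ) Finset.subset_union_left u =
      Finset.restrict₂ (π := fun _ => ℝ) Finset.subset_union_left v)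
    (hB : Finset.restrict₂ (π := fun _ => ℝ) Finset.subset_union_right u =
      Finset.restrict₂ (π := fun _ => ℝ) Finset.subset_union_right v) : u = v := by
  funext ⟨j, hj⟩
  rcases Finset.mem_union.1 hj with h | h
  · exact congrFun hA ⟨j, h⟩
  · exact congrFun hB ⟨j, h⟩

/-- The vector indexed by `A ∪ B` that agrees with `u` on `A` and with `v` on `B \ A`. -/
def glue {A B : Finset (Fin N)} (u : A → ℝ) (v : B → ℝ) : ↥(A ∪ B) → ℝ := fun j =>
  if hA : (j : Fin N) ∈ A then u ⟨j, hA⟩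
  else v ⟨j, (Finset.mem_union.1 j.2).resolve_left hA⟩

variable {A B : Finset (Fin N)}

@[simp]
theorem restrict₂_glue_left (u : A → ℝ) (v : B → ℝ) :
    Finset.restrict₂ (π := fun _ => ℝ) Finset.subset_union_left (glue u v) = u := by
  funext j
  exact dif_pos j.2

/-- On the overlap `glue` takes its values from `u`, so `v` is recovered only if the two agree
there. -/
theorem restrict₂_glue_right {u : A → ℝ} {v : B → ℝ}
    (h : Finset.restrict₂ (π := fun _ => ℝ) (Finset.inter_subset_left : A ∩ B ⊆ A) u =
      Finset.restrict₂ (π := fun _ => ℝ) Finset.inter_subset_right v) :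
    Finset.restrict₂ (π := fun _ => ℝ) Finset.subset_union_right (glue u v) = v := by
  funext j
  by_cases hA : (j : Fin N) ∈ A
  · exact (dif_pos hA).trans (congrFun h ⟨j, Finset.mem_inter.2 ⟨hA, j.2⟩⟩)
  · exact dif_neg hA

theorem contDiffOn_glue {E : Type*} [NormedAddCommGroup E] [NormedSpace ℝ E] {s : Set E}
    {f : E → A → ℝ} {g : E → B → ℝ} (hf : ContDiffOn ℝ ∞ f s) (hg : ContDiffOn ℝ ∞ g s) :
    ContDiffOn ℝ ∞ (fun x => glue (f x) (g x)) s := by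
  refine contDiffOn_pi.2 fun j => ?_
  by_cases hA : (j : Fin N) ∈ A
  · simpa only [glue, dif_pos hA] using contDiffOn_pi.1 hf ⟨j, hA⟩
  · simpa only [glue, dif_neg hA] using contDiffOn_pi.1 hg _

theorem contDiffOn_concat₃ {E : Type*} [NormedAddCommGroup E] [NormedSpace ℝ E] {s : Set E}
    {a : E → ↥(A ∩ B) → ℝ} {b : E → ↥(A \ B) → ℝ} {c : E → ↥(B \ A) → ℝ}
    (ha : ContDiffOn ℝ ∞ a s) (hb : ContDiffOn ℝ ∞ b s) (hc : ContDiffOn ℝ ∞ c s) :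
    ContDiffOn ℝ ∞ (fun x => concat₃ (a x) (b x) (c x)) s := by
  refine contDiffOn_pi.2 fun j => ?_
  by_cases hA : (j : Fin N) ∈ A
  · by_cases hB : (j : Fin N) ∈ B
    · simpa only [concat₃, dif_pos hA, dif_pos hB] using contDiffOn_pi.1 ha _
    · simpa only [concat₃, dif_pos hA, dif_neg hB] using contDiffOn_pi.1 hb _
  · simpa only [concat₃, dif_neg hA] using contDiffOn_pi.1 hc _

theorem inter_subset_union : A ∩ B ⊆ A ∪ B :=
  Finset.inter_subset_left.trans Finset.subset_union_left

theorem sdiff_subset_union_left : A \ B ⊆ A ∪ B :=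
  Finset.sdiff_subset.trans Finset.subset_union_left

theorem sdiff_subset_union_right : B \ A ⊆ A ∪ B :=
  Finset.sdiff_subset.trans Finset.subset_union_right

@[simp]
theorem concat₃_restrict₂ (u : ↥(A ∪ B) → ℝ) :
    concat₃ (Finset.restrict₂ (π := fun _ => ℝ) inter_subset_union u)
      (Finset.restrict₂ (π := fun _ => ℝ) sdiff_subset_union_left u)
      (Finset.restrict₂ (π := fun _ => ℝ) sdiff_subset_union_right u) = u := by
  funext j
  simp only [concat₃]
  split_ifs <;> rfl

variable (a : ↥(A ∩ B) → ℝ) (b : ↥(A \ B) → ℝ) (c : ↥(B \ A) → ℝ)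

@[simp]
theorem restrict₂_concat₃_inter :
    Finset.restrict₂ (π := fun _ => ℝ) inter_subset_union (concat₃ a b c) = a := by
  funext j
  have h := Finset.mem_inter.1 j.2
  exact (dif_pos h.1).trans (dif_pos h.2)

@[simp]
theorem restrict₂_concat₃_sdiff_left :
    Finset.restrict₂ (π := fun _ => ℝ) sdiff_subset_union_left (concat₃ a b c) = b := by
  funext j
  have h := Finset.mem_sdiff.1 j.2
  exact (dif_pos h.1).trans (dif_neg h.2)

@[simp]
theorem restrict₂_concat₃_sdiff_right :
    Finset.restrict₂ (π := fun _ => ℝ) sdiff_subset_union_right (concat₃ a b c) = c := by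
  funext j
  exact dif_neg (Finset.mem_sdiff.1 j.2).2

end Blocks

/-! ### Composition and concatenation of diffeomorphisms. -/

namespace IsDiffeoOnto

variable {E F G : Type*} [NormedAddCommGroup E] [NormedSpace ℝ E] [NormedAddCommGroup F]
  [NormedSpace ℝ F] [NormedAddCommGroup G] [NormedSpace ℝ G]

theorem refl (s : Set E) : IsDiffeoOnto (fun x => x) s s :=
  ⟨contDiffOn_id, fun _ h => h, fun x => x, contDiffOn_id, fun _ h => h, fun _ _ => rfl,
    fun _ _ => rfl⟩

theorem comp {g : F → G} {f : E → F} {s : Set E} {t : Set F} {u : Set G}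
    (hg : IsDiffeoOnto g t u) (hf : IsDiffeoOnto f s t) :
    IsDiffeoOnto (fun x => g (f x)) s u := by
  obtain ⟨hg, hgm, g', hg', hgm', hgl, hgr⟩ := hg
  obtain ⟨hf, hfm, f', hf', hfm', hfl, hfr⟩ := hf
  refine ⟨hg.comp hf hfm, hgm.comp hfm, fun x => f' (g' x), hf'.comp hg' hgm', hfm'.comp hgm',
    fun x hx => ?_, fun x hx => ?_⟩
  · simp only [hgl (hfm hx), hfl hx]
  · simp only [hfr (hgm' hx), hgr hx]

/-- Diffeomorphisms of the parts of a vector give a diffeomorphism of their concatenation. -/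
theorem concat₃ {N : ℕ} {A B : Finset (Fin N)} {r : Fin N → Set ℝ}
    {a : (↥(A ∩ B) → ℝ) → ↥(A ∩ B) → ℝ} {b : (↥(A \ B) → ℝ) → ↥(A \ B) → ℝ}
    {c : (↥(B \ A) → ℝ) → ↥(B \ A) → ℝ}
    {U : Set (↥(A ∩ B) → ℝ)} {V : Set (↥(A \ B) → ℝ)} {W : Set (↥(B \ A) → ℝ)}
    (ha : IsDiffeoOnto a {u | ∀ j : ↥(A ∩ B), u j ∈ r j} U)
    (hb : IsDiffeoOnto b {u | ∀ j : ↥(A \ B), u j ∈ r j} V)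
    (hc : IsDiffeoOnto c {u | ∀ j : ↥(B \ A), u j ∈ r j} W) :
    IsDiffeoOnto (fun u : ↥(A ∪ B) → ℝ =>
        concat₃ (a (Finset.restrict₂ (π := fun _ => ℝ) inter_subset_union u))
          (b (Finset.restrict₂ (π := fun _ => ℝ) sdiff_subset_union_left u))
          (c (Finset.restrict₂ (π := fun _ => ℝ) sdiff_subset_union_right u)))
      {u | ∀ j : ↥(A ∪ B), u j ∈ r j}
      {w | Finset.restrict₂ (π := fun _ => ℝ) inter_subset_union w ∈ U ∧
        Finset.restrict₂ (π := fun _ => ℝ) sdiff_subset_union_left w ∈ V ∧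
        Finset.restrict₂ (π := fun _ => ℝ) sdiff_subset_union_right w ∈ W} := by
  obtain ⟨ha, ham, a', ha', ham', hal, har⟩ := ha
  obtain ⟨hb, hbm, b', hb', hbm', hbl, hbr⟩ := hb
  obtain ⟨hc, hcm, c', hc', hcm', hcl, hcr⟩ := hc
  have mI : ∀ u : ↥(A ∪ B) → ℝ, (∀ j : ↥(A ∪ B), u j ∈ r j) →
      ∀ j : ↥(A ∩ B),
        Finset.restrict₂ (π := fun _ => ℝ) (inter_subset_union : A ∩ B ⊆ A ∪ B) u j ∈ r j :=
    fun u hu j => hu ⟨j, inter_subset_union j.2⟩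
  have mL : ∀ u : ↥(A ∪ B) → ℝ, (∀ j : ↥(A ∪ B), u j ∈ r j) →
      ∀ j : ↥(A \ B),
        Finset.restrict₂ (π := fun _ => ℝ) (sdiff_subset_union_left : A \ B ⊆ A ∪ B) u j ∈ r j :=
    fun u hu j => hu ⟨j, sdiff_subset_union_left j.2⟩
  have mR : ∀ u : ↥(A ∪ B) → ℝ, (∀ j : ↥(A ∪ B), u j ∈ r j) →
      ∀ j : ↥(B \ A),
        Finset.restrict₂ (π := fun _ => ℝ) (sdiff_subset_union_right : B \ A ⊆ A ∪ B) u j ∈ r j :=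
    fun u hu j => hu ⟨j, sdiff_subset_union_right j.2⟩
  refine ⟨contDiffOn_concat₃ (ha.comp (contDiff_restrict₂ _).contDiffOn mI)
      (hb.comp (contDiff_restrict₂ _).contDiffOn mL)
      (hc.comp (contDiff_restrict₂ _).contDiffOn mR), fun u hu => ?_,
    fun w => _root_.concat₃ (a' (Finset.restrict₂ (π := fun _ => ℝ) inter_subset_union w))
      (b' (Finset.restrict₂ (π := fun _ => ℝ) sdiff_subset_union_left w))
      (c' (Finset.restrict₂ (π := fun _ => ℝ) sdiff_subset_union_right w)),
    contDiffOn_concat₃ (ha'.comp (contDiff_restrict₂ _).contDiffOn fun _ h => h.1)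
      (hb'.comp (contDiff_restrict₂ _).contDiffOn fun _ h => h.2.1)
      (hc'.comp (contDiff_restrict₂ _).contDiffOn fun _ h => h.2.2), fun w hw j => ?_,
    fun u hu => ?_, fun w hw => ?_⟩
  · simpa using ⟨ham (mI u hu), hbm (mL u hu), hcm (mR u hu)⟩
  · simp only [_root_.concat₃]
    split_ifs
    · exact ham' hw.1 ⟨j, _⟩
    · exact hbm' hw.2.1 ⟨j, _⟩
    · exact hcm' hw.2.2 ⟨j, _⟩
  · simp only [restrict₂_concat₃_inter, restrict₂_concat₃_sdiff_left,
      restrict₂_concat₃_sdiff_right, hal (mI u hu), hbl (mL u hu), hcl (mR u hu),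
      concat₃_restrict₂]
  · simp only [restrict₂_concat₃_inter, restrict₂_concat₃_sdiff_left,
      restrict₂_concat₃_sdiff_right, har hw.1, hbr hw.2.1, hcr hw.2.2, concat₃_restrict₂]

end IsDiffeoOnto

/-! ### Points of the latent space and null sets of its law. -/

namespace MultiViewModel

variable {N K : ℕ} {d : Fin K → ℕ} (M : MultiViewModel N K d)

theorem latent_nonempty : M.latent.Nonempty := by
  have := M.simplyConnected_latent
  exact Set.nonempty_coe_sort.1 (inferInstanceAs (Nonempty (Set.univ.pi M.range)))

theorem subvec_mem_latentBlock {z : Fin N → ℝ} (hz : z ∈ M.latent) (A : Finset (Fin N)) :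
    subvec A z ∈ M.latentBlock A :=
  fun j => hz j trivial

theorem restrict₂_mem_latentBlock {A B : Finset (Fin N)} (h : A ⊆ B) {u : B → ℝ}
    (hu : u ∈ M.latentBlock B) :
    Finset.restrict₂ (π := fun _ => ℝ) h u ∈ M.latentBlock A :=
  fun j => hu ⟨j, h j.2⟩

theorem glue_mem_latentBlock {A B : Finset (Fin N)} {u : A → ℝ} {v : B → ℝ}
    (hu : u ∈ M.latentBlock A) (hv : v ∈ M.latentBlock B) :
    glue u v ∈ M.latentBlock (A ∪ B) := by
  intro j
  simp only [glue]
  split_ifs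
  · exact hu ⟨j, _⟩
  · exact hv ⟨j, _⟩

/-- The latent space is a product, so the missing coordinates can be filled in from any fixed latent
point. -/
theorem exists_subvec_eq {A : Finset (Fin N)} {u : A → ℝ} (hu : u ∈ M.latentBlock A) :
    ∃ z ∈ M.latent, subvec A z = u := by
  obtain ⟨z₀, hz₀⟩ := M.latent_nonempty
  refine ⟨fun j => if h : j ∈ A then u ⟨j, h⟩ else z₀ j, fun j _ => ?_,
    funext fun j => dif_pos j.2⟩
  by_cases h : j ∈ A
  · simpa only [dif_pos h] using hu ⟨j, h⟩
  · simpa only [dif_neg h] using hz₀ j trivial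

/-- As the density is positive almost everywhere, Lebesgue measure on the latent space is absolutely
continuous with respect to the law. This turns almost sure continuous equations into pointwise ones.
-/
theorem law_pos_of_isOpen {V : Set (Fin N → ℝ)} (hV : IsOpen V) (hVs : V ⊆ M.latent)
    (hne : V.Nonempty) : M.law V ≠ 0 := by
  have hm : MeasurableSet M.latent := M.isOpen_latent.measurableSet
  have hac : volume.restrict M.latent ≪ M.law := by
    refine withDensity_absolutelyContinuous' ?_ ?_
    · exact (M.density_smooth.continuousOn.aemeasurable hm).ennreal_ofReal
    · filter_upwards [M.density_pos] with z hz
      simpa using hz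
  intro h0
  have h1 := hac h0
  rw [Measure.restrict_apply hV.measurableSet, Set.inter_eq_left.2 hVs] at h1
  exact hV.measure_ne_zero volume hne h1

/-- Needed to evaluate `Measure.map`, which is zero by default for maps that are not a.e.
measurable. -/
theorem aemeasurable_of_continuousOn {E : Type*} [TopologicalSpace E] [MeasurableSpace E]
    [BorelSpace E] {f : (Fin N → ℝ) → E} (hf : ContinuousOn f M.latent) :
    AEMeasurable f M.law :=
  (hf.aemeasurable M.isOpen_latent.measurableSet).mono_ac (withDensity_absolutelyContinuous _ _)

theorem law_eq_zero_of_disjoint {V : Set (Fin N → ℝ)} (hV : Disjoint V M.latent) :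
    M.law V = 0 := by
  refine withDensity_absolutelyContinuous _ _ ?_
  rw [Measure.restrict_apply' (s := M.latent) M.isOpen_latent.measurableSet, hV.inter_eq,
    measure_empty]

/-- Functions of latent variables with the same law in two models satisfy the same continuous
equations. -/
theorem eqOn_of_map_law_eq {M : MultiViewModel N K d} {K' : ℕ} {d' : Fin K' → ℕ} {M' : MultiViewModel N K' d'}
    {E X : Type*} [TopologicalSpace E] [MeasurableSpace E] [BorelSpace E] [TopologicalSpace X]
    [T2Space X] {f f' : (Fin N → ℝ) → E} (hf : ContinuousOn f M.latent)
    (hf' : ContinuousOn f' M'.latent) (hlaw : M'.law.map f' = M.law.map f) {T : Set E}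
    (hfT : Set.MapsTo f M.latent T) (hfT' : Set.MapsTo f' M'.latent T) {p q : E → X}
    (hp : ContinuousOn p T) (hq : ContinuousOn q T)
    (hpq : ∀ z ∈ M.latent, p (f z) = q (f z)) : ∀ z ∈ M'.latent, p (f' z) = q (f' z) := by
  intro z hz
  by_contra hne
  -- `p` and `q` are continuous only on `T`, which need not be measurable; `O` is an open set of the
  -- whole space whose trace on `T` is the set where they differ.
  obtain ⟨O, hO, hOT⟩ := continuousOn_iff'.1 (hp.prodMk hq) _
    (isClosed_diagonal (X := X)).isOpen_compl
  have hmem : ∀ w ∈ T, w ∈ O ↔ p w ≠ q w := fun w hw => by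
    have := Set.ext_iff.1 hOT w
    simpa [hw] using this.symm
  have h0 : M.law.map f O = 0 := by
    rw [Measure.map_apply_of_aemeasurable (M.aemeasurable_of_continuousOn hf) hO.measurableSet]
    refine M.law_eq_zero_of_disjoint (Set.disjoint_left.2 fun y hy hyM => ?_)
    exact (hmem _ (hfT hyM)).1 hy (hpq y hyM)
  rw [← hlaw,
    Measure.map_apply_of_aemeasurable (M'.aemeasurable_of_continuousOn hf') hO.measurableSet] at h0
  exact M'.law_pos_of_isOpen (hf'.isOpen_inter_preimage M'.isOpen_latent hO)
    Set.inter_subset_left ⟨z, hz, (hmem _ (hfT' hz)).2 hne⟩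
    (measure_mono_null Set.inter_subset_right h0)

/-! ### Transition maps between the blocks of two models. -/

variable {M} {K' : ℕ} {d' : Fin K' → ℕ} {M' : MultiViewModel N K' d'} {A B : Finset (Fin N)}

/-- If the `A`-part of a diffeomorphism of the block `B ⊇ A` between two models depends only on the
`A`-part of its argument, and the same holds for its inverse, then it induces a diffeomorphism of
the block `A`. -/
theorem exists_isDiffeoOnto_restrict₂ (h : A ⊆ B) {f g : (B → ℝ) → B → ℝ}
    (hf : ContDiffOn ℝ ∞ f (M'.latentBlock B)) (hg : ContDiffOn ℝ ∞ g (M.latentBlock B))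
    (hfm : Set.MapsTo f (M'.latentBlock B) (M.latentBlock B))
    (hgm : Set.MapsTo g (M.latentBlock B) (M'.latentBlock B))
    (hgf : Set.LeftInvOn g f (M'.latentBlock B)) (hfg : Set.RightInvOn g f (M.latentBlock B))
    (hfi : ∀ u ∈ M'.latentBlock B, ∀ v ∈ M'.latentBlock B,
      Finset.restrict₂ (π := fun _ => ℝ) h u = Finset.restrict₂ (π := fun _ => ℝ) h v →
      Finset.restrict₂ (π := fun _ => ℝ) h (f u) = Finset.restrict₂ (π := fun _ => ℝ) h (f v))
    (hgi : ∀ u ∈ M.latentBlock B, ∀ v ∈ M.latentBlock B,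
      Finset.restrict₂ (π := fun _ => ℝ) h u = Finset.restrict₂ (π := fun _ => ℝ) h v →
      Finset.restrict₂ (π := fun _ => ℝ) h (g u) = Finset.restrict₂ (π := fun _ => ℝ) h (g v)) :
    ∃ ψ : (A → ℝ) → A → ℝ, IsDiffeoOnto ψ (M'.latentBlock A) (M.latentBlock A) ∧
      ∀ u ∈ M'.latentBlock B, ψ (Finset.restrict₂ (π := fun _ => ℝ) h u) =
        Finset.restrict₂ (π := fun _ => ℝ) h (f u) := by
  -- A smooth section of the restriction to `A`: the coordinates outside `A` are frozen at a latent
  -- point. The choice is harmless by `hfi` and `hgi`.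
  have ext : ∀ {K : ℕ} {d : Fin K → ℕ} (M : MultiViewModel N K d), ∃ e : (A → ℝ) → B → ℝ,
      ContDiff ℝ ∞ e ∧ Set.MapsTo e (M.latentBlock A) (M.latentBlock B) ∧
      ∀ u, Finset.restrict₂ (π := fun _ => ℝ) h (e u) = u := by
    intro K d M
    obtain ⟨z, hz⟩ := M.latent_nonempty
    refine ⟨fun u j => if hj : (j : Fin N) ∈ A then u ⟨j, hj⟩ else z j, ?_, fun u hu j => ?_,
      fun u => funext fun j => dif_pos j.2⟩
    · refine contDiff_pi.2 fun j => ?_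
      by_cases hj : (j : Fin N) ∈ A
      · simpa only [dif_pos hj] using contDiff_apply ℝ ℝ (⟨j, hj⟩ : A)
      · simpa only [dif_neg hj] using contDiff_const
    · by_cases hj : (j : Fin N) ∈ A
      · simpa only [dif_pos hj] using hu ⟨j, hj⟩
      · simpa only [dif_neg hj] using hz j trivial
  obtain ⟨e, he, hem, hr⟩ := ext M
  obtain ⟨e', he', hem', hr'⟩ := ext M'
  have hfr := fun u hu => M.restrict₂_mem_latentBlock h (hfm (hem' (x := u) hu))
  have hgr := fun u hu => M'.restrict₂_mem_latentBlock h (hgm (hem (x := u) hu))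
  refine ⟨fun u => Finset.restrict₂ (π := fun _ => ℝ) h (f (e' u)),
    ⟨(contDiff_restrict₂ h).comp_contDiffOn (hf.comp he'.contDiffOn hem'), hfr,
      fun u => Finset.restrict₂ (π := fun _ => ℝ) h (g (e u)),
      (contDiff_restrict₂ h).comp_contDiffOn (hg.comp he.contDiffOn hem), hgr, ?_, ?_⟩, ?_⟩
  · intro u hu
    have := hgi _ (hem (hfr u hu)) _ (hfm (hem' hu)) (hr _)
    simp only [this, hgf (hem' hu), hr']
  · intro u hu
    have := hfi _ (hem' (hgr u hu)) _ (hgm (hem hu)) (hr' _)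
    simp only [this, hfg (hem hu), hr]
  · exact fun u hu => hfi _ (hem' (M'.restrict₂_mem_latentBlock h hu)) _ hu (hr' _)

/-- Componentwise action on the two halves of a vector indexed by `A ∪ B`. -/
def glueMap (φ : (A → ℝ) → A → ℝ) (χ : (B → ℝ) → B → ℝ) (u : ↥(A ∪ B) → ℝ) : ↥(A ∪ B) → ℝ :=
  glue (φ (Finset.restrict₂ (π := fun _ => ℝ) Finset.subset_union_left u))
    (χ (Finset.restrict₂ (π := fun _ => ℝ) Finset.subset_union_right u))

/-- The maps `φ` and `χ` of the blocks `A` and `B` agree on the common coordinates. -/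
def Compatible (M : MultiViewModel N K d) (φ : (A → ℝ) → A → ℝ) (χ : (B → ℝ) → B → ℝ) : Prop :=
  ∀ z ∈ M.latent, Finset.restrict₂ (π := fun _ => ℝ) (Finset.inter_subset_left : A ∩ B ⊆ A)
      (φ (subvec A z)) =
    Finset.restrict₂ (π := fun _ => ℝ) Finset.inter_subset_right (χ (subvec B z))

section glueMap

variable {φ : (A → ℝ) → A → ℝ} {χ : (B → ℝ) → B → ℝ}

theorem restrict₂_glueMap_left (u : ↥(A ∪ B) → ℝ) :
    Finset.restrict₂ (π := fun _ => ℝ) Finset.subset_union_left (glueMap φ χ u) =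
      φ (Finset.restrict₂ (π := fun _ => ℝ) Finset.subset_union_left u) :=
  restrict₂_glue_left _ _

theorem Compatible.restrict₂_glueMap_right (hc : M.Compatible φ χ) {u : ↥(A ∪ B) → ℝ}
    (hu : u ∈ M.latentBlock (A ∪ B)) :
    Finset.restrict₂ (π := fun _ => ℝ) Finset.subset_union_right (glueMap φ χ u) =
      χ (Finset.restrict₂ (π := fun _ => ℝ) Finset.subset_union_right u) := by
  obtain ⟨z, hz, rfl⟩ := M.exists_subvec_eq hu
  exact restrict₂_glue_right (hc z hz)

theorem contDiffOn_glueMap (hφ : ContDiffOn ℝ ∞ φ (M.latentBlock A))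
    (hχ : ContDiffOn ℝ ∞ χ (M.latentBlock B)) :
    ContDiffOn ℝ ∞ (glueMap φ χ) (M.latentBlock (A ∪ B)) :=
  contDiffOn_glue
    (hφ.comp (contDiff_restrict₂ _).contDiffOn fun _ hu => M.restrict₂_mem_latentBlock _ hu)
    (hχ.comp (contDiff_restrict₂ _).contDiffOn fun _ hu => M.restrict₂_mem_latentBlock _ hu)

theorem mapsTo_glueMap (hφ : Set.MapsTo φ (M'.latentBlock A) (M.latentBlock A))
    (hχ : Set.MapsTo χ (M'.latentBlock B) (M.latentBlock B)) :
    Set.MapsTo (glueMap φ χ) (M'.latentBlock (A ∪ B)) (M.latentBlock (A ∪ B)) :=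
  fun _ hu => M.glue_mem_latentBlock (hφ (M'.restrict₂_mem_latentBlock _ hu))
    (hχ (M'.restrict₂_mem_latentBlock _ hu))

theorem Compatible.leftInvOn_glueMap {φ' : (A → ℝ) → A → ℝ} {χ' : (B → ℝ) → B → ℝ}
    (hc : M'.Compatible φ χ) (hc' : M.Compatible φ' χ')
    (hφ : Set.MapsTo φ (M'.latentBlock A) (M.latentBlock A))
    (hχ : Set.MapsTo χ (M'.latentBlock B) (M.latentBlock B))
    (hφ' : Set.LeftInvOn φ' φ (M'.latentBlock A)) (hχ' : Set.LeftInvOn χ' χ (M'.latentBlock B)) :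
    Set.LeftInvOn (glueMap φ' χ') (glueMap φ χ) (M'.latentBlock (A ∪ B)) := by
  intro u hu
  apply eq_of_restrict₂_union_eq
  · rw [restrict₂_glueMap_left, restrict₂_glueMap_left,
      hφ' (M'.restrict₂_mem_latentBlock _ hu)]
  · rw [hc'.restrict₂_glueMap_right (mapsTo_glueMap hφ hχ hu), hc.restrict₂_glueMap_right hu,
      hχ' (M'.restrict₂_mem_latentBlock _ hu)]

/-- The intersection part of a compatible pair depends only on the intersection part of the
argument, since it depends neither on `A \ B` nor on `B \ A`. -/
theorem Compatible.restrict₂_inter_glueMap_eq (hc : M.Compatible φ χ) {u v : ↥(A ∪ B) → ℝ}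
    (hu : u ∈ M.latentBlock (A ∪ B)) (hv : v ∈ M.latentBlock (A ∪ B))
    (huv : Finset.restrict₂ (π := fun _ => ℝ) inter_subset_union u =
      Finset.restrict₂ (π := fun _ => ℝ) inter_subset_union v) :
    Finset.restrict₂ (π := fun _ => ℝ) inter_subset_union (glueMap φ χ u) =
      Finset.restrict₂ (π := fun _ => ℝ) inter_subset_union (glueMap φ χ v) := by
  have hur := M.restrict₂_mem_latentBlock Finset.subset_union_left hu
  have hvr := M.restrict₂_mem_latentBlock Finset.subset_union_right hv
  -- An intermediate point: from `u` to `w` only `B \ A` changes, which `φ` does not see; from `w`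
  -- to `v` only `A \ B` changes, which `χ` does not see.
  obtain ⟨w, hw, hwA, hwB⟩ : ∃ w ∈ M.latentBlock (A ∪ B),
      Finset.restrict₂ (π := fun _ => ℝ) Finset.subset_union_left w =
        Finset.restrict₂ (π := fun _ => ℝ) Finset.subset_union_left u ∧
      Finset.restrict₂ (π := fun _ => ℝ) Finset.subset_union_right w =
        Finset.restrict₂ (π := fun _ => ℝ) Finset.subset_union_right v :=
    ⟨_, M.glue_mem_latentBlock hur hvr, restrict₂_glue_left _ _, restrict₂_glue_right huv⟩
  have h₁ : Finset.restrict₂ (π := fun _ => ℝ) Finset.subset_union_left (glueMap φ χ u) =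
      Finset.restrict₂ (π := fun _ => ℝ) Finset.subset_union_left (glueMap φ χ w) := by
    rw [restrict₂_glueMap_left, restrict₂_glueMap_left, hwA]
  have h₂ : Finset.restrict₂ (π := fun _ => ℝ) Finset.subset_union_right (glueMap φ χ w) =
      Finset.restrict₂ (π := fun _ => ℝ) Finset.subset_union_right (glueMap φ χ v) := by
    rw [hc.restrict₂_glueMap_right hw, hc.restrict₂_glueMap_right hv, hwB]
  exact (congrArg (Finset.restrict₂ (π := fun _ => ℝ) Finset.inter_subset_left) h₁).trans
    (congrArg (Finset.restrict₂ (π := fun _ => ℝ) Finset.inter_subset_right) h₂)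

end glueMap

/-- Two pairs of diffeomorphisms of the blocks `A` and `B` onto the same sets of values, with the
same joint law, agree on the common coordinates after passing from one model to the other. -/
theorem compatible_of_map_law_eq {W₁ : Set (A → ℝ)} {W₂ : Set (B → ℝ)}
    {h₁ e₁ h₁' : (A → ℝ) → A → ℝ} {h₂ e₂ h₂' : (B → ℝ) → B → ℝ}
    {f f' : (Fin N → ℝ) → (A → ℝ) × (B → ℝ)}
    (hf : ∀ z ∈ M.latent, f z = (h₁ (subvec A z), h₂ (subvec B z)))
    (hf' : ∀ z ∈ M'.latent, f' z = (h₁' (subvec A z), h₂' (subvec B z)))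
    (hlaw : M'.law.map f' = M.law.map f)
    (hh₁ : ContDiffOn ℝ ∞ h₁ (M.latentBlock A)) (hh₂ : ContDiffOn ℝ ∞ h₂ (M.latentBlock B))
    (hh₁' : ContDiffOn ℝ ∞ h₁' (M'.latentBlock A)) (hh₂' : ContDiffOn ℝ ∞ h₂' (M'.latentBlock B))
    (hm₁ : Set.MapsTo h₁ (M.latentBlock A) W₁) (hm₂ : Set.MapsTo h₂ (M.latentBlock B) W₂)
    (hm₁' : Set.MapsTo h₁' (M'.latentBlock A) W₁) (hm₂' : Set.MapsTo h₂' (M'.latentBlock B) W₂)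
    (he₁ : ContDiffOn ℝ ∞ e₁ W₁) (he₂ : ContDiffOn ℝ ∞ e₂ W₂)
    (hl₁ : Set.LeftInvOn e₁ h₁ (M.latentBlock A)) (hl₂ : Set.LeftInvOn e₂ h₂ (M.latentBlock B)) :
    M'.Compatible (fun u => e₁ (h₁' u)) (fun u => e₂ (h₂' u)) := by
  have cont : ∀ {K : ℕ} {d : Fin K → ℕ} {M : MultiViewModel N K d} {h₁ : (A → ℝ) → A → ℝ}
      {h₂ : (B → ℝ) → B → ℝ} {f : (Fin N → ℝ) → (A → ℝ) × (B → ℝ)},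
      (∀ z ∈ M.latent, f z = (h₁ (subvec A z), h₂ (subvec B z))) →
      ContDiffOn ℝ ∞ h₁ (M.latentBlock A) → ContDiffOn ℝ ∞ h₂ (M.latentBlock B) →
      ContinuousOn f M.latent := fun {_ _ M _ _ _} hf hh₁ hh₂ =>
    ((hh₁.continuousOn.comp (contDiff_subvec A).continuous.continuousOn
      fun _ hz => M.subvec_mem_latentBlock hz A).prodMk
      (hh₂.continuousOn.comp (contDiff_subvec B).continuous.continuousOn
        fun _ hz => M.subvec_mem_latentBlock hz B)).congr hf
  have key := eqOn_of_map_law_eq (T := W₁ ×ˢ W₂)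
    (p := fun w => Finset.restrict₂ (π := fun _ => ℝ) Finset.inter_subset_left (e₁ w.1))
    (q := fun w => Finset.restrict₂ (π := fun _ => ℝ) (Finset.inter_subset_right : A ∩ B ⊆ B)
      (e₂ w.2))
    (cont hf hh₁ hh₂) (cont hf' hh₁' hh₂') hlaw
    (fun z hz => by
      rw [hf z hz]
      exact ⟨hm₁ (M.subvec_mem_latentBlock hz A), hm₂ (M.subvec_mem_latentBlock hz B)⟩)
    (fun z hz => by
      rw [hf' z hz]
      exact ⟨hm₁' (M'.subvec_mem_latentBlock hz A), hm₂' (M'.subvec_mem_latentBlock hz B)⟩)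
    ((contDiff_restrict₂ _).continuous.comp_continuousOn
      (he₁.continuousOn.comp continuousOn_fst fun _ hw => hw.1))
    ((contDiff_restrict₂ _).continuous.comp_continuousOn
      (he₂.continuousOn.comp continuousOn_snd fun _ hw => hw.2))
    -- In the reference model both sides are `z_{A ∩ B}`.
    (fun z hz => by
      simp only [hf z hz, hl₁ (M.subvec_mem_latentBlock hz A),
        hl₂ (M.subvec_mem_latentBlock hz B)]
      rfl)
  intro z hz
  simpa only [hf' z hz] using key z hz

/-- Functions of a pair of representations that block-identify the intersection and the two set
differences in one model block-identify the intersection and, concatenated, the union in each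
model with the same law of the pair. -/
theorem blockIdentifies_inter_and_union_of_map_law_eq {W₁ : Set (A → ℝ)} {W₂ : Set (B → ℝ)}
    {k₁ k₂ : Fin K} {l₁ l₂ : Fin K'}
    {g₁ : (Fin (d k₁) → ℝ) → (A → ℝ)} {g₂ : (Fin (d k₂) → ℝ) → (B → ℝ)}
    {g₁' : (Fin (d' l₁) → ℝ) → (A → ℝ)} {g₂' : (Fin (d' l₂) → ℝ) → (B → ℝ)}
    (hg₁ : M.BlockIdentifiesOnto A W₁ fun x => g₁ (x k₁))
    (hg₂ : M.BlockIdentifiesOnto B W₂ fun x => g₂ (x k₂))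
    (hg₁' : M'.BlockIdentifiesOnto A W₁ fun x => g₁' (x l₁))
    (hg₂' : M'.BlockIdentifiesOnto B W₂ fun x => g₂' (x l₂))
    (hlaw : M'.law.map (fun z => encodePair l₁ l₂ g₁' g₂' (M'.views z)) =
      M.law.map (fun z => encodePair k₁ k₂ g₁ g₂ (M.views z)))
    {a : (A → ℝ) × (B → ℝ) → (↥(A ∩ B) → ℝ)} {b : (A → ℝ) × (B → ℝ) → (↥(A \ B) → ℝ)}
    {c : (A → ℝ) × (B → ℝ) → (↥(B \ A) → ℝ)}
    (ha : M.BlockIdentifies (A ∩ B) fun x => a (encodePair k₁ k₂ g₁ g₂ x))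
    (hb : M.BlockIdentifies (A \ B) fun x => b (encodePair k₁ k₂ g₁ g₂ x))
    (hc : M.BlockIdentifies (B \ A) fun x => c (encodePair k₁ k₂ g₁ g₂ x)) :
    M'.BlockIdentifies (A ∩ B) (fun x => a (encodePair l₁ l₂ g₁' g₂' x)) ∧
    M'.BlockIdentifies (A ∪ B) (fun x => concat₃ (a (encodePair l₁ l₂ g₁' g₂' x))
      (b (encodePair l₁ l₂ g₁' g₂' x)) (c (encodePair l₁ l₂ g₁' g₂' x))) := by
  obtain ⟨h₁, ⟨hh₁, hm₁, e₁, he₁, hn₁, hl₁, hr₁⟩, hz₁⟩ := hg₁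
  obtain ⟨h₂, ⟨hh₂, hm₂, e₂, he₂, hn₂, hl₂, hr₂⟩, hz₂⟩ := hg₂
  obtain ⟨h₁', ⟨hh₁', hm₁', e₁', he₁', hn₁', hl₁', hr₁'⟩, hz₁'⟩ := hg₁'
  obtain ⟨h₂', ⟨hh₂', hm₂', e₂', he₂', hn₂', hl₂', hr₂'⟩, hz₂'⟩ := hg₂'
  have hp : ∀ z ∈ M.latent, encodePair k₁ k₂ g₁ g₂ (M.views z) =
      (h₁ (subvec A z), h₂ (subvec B z)) := fun z hz => Prod.ext (hz₁ z hz) (hz₂ z hz)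
  have hp' : ∀ z ∈ M'.latent, encodePair l₁ l₂ g₁' g₂' (M'.views z) =
      (h₁' (subvec A z), h₂' (subvec B z)) := fun z hz => Prod.ext (hz₁' z hz) (hz₂' z hz)
  have hC := compatible_of_map_law_eq hp hp' hlaw hh₁ hh₂ hh₁' hh₂' hm₁ hm₂ hm₁' hm₂' he₁ he₂
    hl₁ hl₂
  have hC' := compatible_of_map_law_eq hp' hp hlaw.symm hh₁' hh₂' hh₁ hh₂ hm₁' hm₂' hm₁ hm₂ he₁'
    he₂' hl₁' hl₂'
  have hφ : Set.MapsTo (fun u => e₁ (h₁' u)) (M'.latentBlock A) (M.latentBlock A) :=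
    hn₁.comp hm₁'
  have hχ : Set.MapsTo (fun u => e₂ (h₂' u)) (M'.latentBlock B) (M.latentBlock B) :=
    hn₂.comp hm₂'
  have hφ' : Set.MapsTo (fun u => e₁' (h₁ u)) (M.latentBlock A) (M'.latentBlock A) :=
    hn₁'.comp hm₁
  have hχ' : Set.MapsTo (fun u => e₂' (h₂ u)) (M.latentBlock B) (M'.latentBlock B) :=
    hn₂'.comp hm₂
  have hΦ := contDiffOn_glueMap (φ := fun u => e₁ (h₁' u)) (χ := fun u => e₂ (h₂' u))
    (he₁.comp hh₁' hm₁') (he₂.comp hh₂' hm₂')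
  have hΨ := contDiffOn_glueMap (φ := fun u => e₁' (h₁ u)) (χ := fun u => e₂' (h₂ u))
    (he₁'.comp hh₁ hm₁) (he₂'.comp hh₂ hm₂)
  have hΦm := mapsTo_glueMap hφ hχ
  have hΨm := mapsTo_glueMap hφ' hχ'
  -- The cancellation `e₁' ∘ h₁ ∘ e₁ ∘ h₁' = id` uses that both models share `W₁`; likewise for
  -- `W₂`.
  have hΨΦ := hC.leftInvOn_glueMap hC' hφ hχ
    (fun u hu => by simp only [hr₁ (hm₁' hu), hl₁' hu])
    (fun u hu => by simp only [hr₂ (hm₂' hu), hl₂' hu])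
  have hΦΨ := hC'.leftInvOn_glueMap hC hφ' hχ'
    (fun u hu => by simp only [hr₁' (hm₁ hu), hl₁ hu])
    (fun u hu => by simp only [hr₂' (hm₂ hu), hl₂ hu])
  -- Every latent point of `M'` has a partner in `M` with the same representations, because `h₁ ∘
  -- e₁` and `h₂ ∘ e₂` are the identity on `W₁` and `W₂`.
  have hpair : ∀ z' ∈ M'.latent, ∃ z ∈ M.latent,
      subvec (A ∪ B) z = glueMap (fun u => e₁ (h₁' u)) (fun u => e₂ (h₂' u))
        (subvec (A ∪ B) z') ∧
      encodePair l₁ l₂ g₁' g₂' (M'.views z') = encodePair k₁ k₂ g₁ g₂ (M.views z) := by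
    intro z' hz'
    have hu := M'.subvec_mem_latentBlock hz' (A ∪ B)
    obtain ⟨z, hz, hzu⟩ := M.exists_subvec_eq (hΦm hu)
    have hA : subvec A z = e₁ (h₁' (subvec A z')) :=
      (congrArg (Finset.restrict₂ (π := fun _ => ℝ) Finset.subset_union_left) hzu).trans
        (restrict₂_glueMap_left _)
    have hB : subvec B z = e₂ (h₂' (subvec B z')) :=
      (congrArg (Finset.restrict₂ (π := fun _ => ℝ) Finset.subset_union_right) hzu).trans
        (hC.restrict₂_glueMap_right hu)
    refine ⟨z, hz, hzu, ?_⟩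
    rw [hp z hz, hp' z' hz', hA, hB, hr₁ (hm₁' (M'.subvec_mem_latentBlock hz' A)),
      hr₂ (hm₂' (M'.subvec_mem_latentBlock hz' B))]
  obtain ⟨U, α, hα, hza⟩ := ha
  obtain ⟨V, β, hβ, hzb⟩ := hb
  obtain ⟨W, γ, hγ, hzc⟩ := hc
  constructor
  · obtain ⟨ψ, hψ, hψu⟩ := exists_isDiffeoOnto_restrict₂ inter_subset_union hΦ hΨ hΦm hΨm hΨΦ hΦΨ
      (fun u hu v hv h => hC.restrict₂_inter_glueMap_eq hu hv h)
      (fun u hu v hv h => hC'.restrict₂_inter_glueMap_eq hu hv h)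
    refine ⟨U, _, hα.comp hψ, fun z' hz' => ?_⟩
    obtain ⟨z, hz, hzu, hzz⟩ := hpair z' hz'
    have h := hψu _ (M'.subvec_mem_latentBlock hz' (A ∪ B))
    rw [← hzu] at h
    simp only [hzz]
    exact (hza z hz).trans (congrArg α h.symm)
  · refine ⟨_, _, (hα.concat₃ hβ hγ).comp ⟨hΦ, hΦm, _, hΨ, hΨm, hΨΦ, hΦΨ⟩, fun z' hz' => ?_⟩
    obtain ⟨z, hz, hzu, hzz⟩ := hpair z' hz'
    simp only [hzz, ← hzu, hza z hz, hzb z hz, hzc z hz]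
    rfl

end MultiViewModel

theorem mainTheorem5 {N K : ℕ} {d : Fin K → ℕ} (M : MultiViewModel N K d)
    (C₁ C₂ : Finset (Fin N)) (W₁ : Set (C₁ → ℝ)) (W₂ : Set (C₂ → ℝ))
    (k₁ k₂ : Fin K)
    (g₁ : (Fin (d k₁) → ℝ) → (C₁ → ℝ)) (g₂ : (Fin (d k₂) → ℝ) → (C₂ → ℝ))
    (hg₁ : M.BlockIdentifiesOnto C₁ W₁ fun x => g₁ (x k₁))
    (hg₂ : M.BlockIdentifiesOnto C₂ W₂ fun x => g₂ (x k₂))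
    (hind : M.PartsIndependent C₁ C₂) :
    -- the parts are block-identified by smooth functions of the two representations, and their
    -- concatenation block-identifies the union
    (∃ (a : (C₁ → ℝ) × (C₂ → ℝ) → (↥(C₁ ∩ C₂) → ℝ))
       (b : (C₁ → ℝ) × (C₂ → ℝ) → (↥(C₁ \ C₂) → ℝ))
       (c : (C₁ → ℝ) × (C₂ → ℝ) → (↥(C₂ \ C₁) → ℝ)),
      ContDiffOn ℝ ∞ a (W₁ ×ˢ W₂) ∧ ContDiffOn ℝ ∞ b (W₁ ×ˢ W₂) ∧
      ContDiffOn ℝ ∞ c (W₁ ×ˢ W₂) ∧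
      M.BlockIdentifiesOnto (C₁ ∩ C₂) (M.latentBlock (C₁ ∩ C₂))
        (fun x => a (encodePair k₁ k₂ g₁ g₂ x)) ∧
      M.BlockIdentifiesOnto (C₁ \ C₂) (M.latentBlock (C₁ \ C₂))
        (fun x => b (encodePair k₁ k₂ g₁ g₂ x)) ∧
      M.BlockIdentifiesOnto (C₂ \ C₁) (M.latentBlock (C₂ \ C₁))
        (fun x => c (encodePair k₁ k₂ g₁ g₂ x)) ∧
      M.BlockIdentifiesOnto (C₁ ∪ C₂) (M.latentBlock (C₁ ∪ C₂))
        (fun x => concat₃ (a (encodePair k₁ k₂ g₁ g₂ x)) (b (encodePair k₁ k₂ g₁ g₂ x))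
          (c (encodePair k₁ k₂ g₁ g₂ x)))) ∧
    -- whichever functions block-identify the parts, their concatenation block-identifies the union,
    -- in this model and in every other one with the same law of the pair of representations
    (∀ (a : (C₁ → ℝ) × (C₂ → ℝ) → (↥(C₁ ∩ C₂) → ℝ))
       (b : (C₁ → ℝ) × (C₂ → ℝ) → (↥(C₁ \ C₂) → ℝ))
       (c : (C₁ → ℝ) × (C₂ → ℝ) → (↥(C₂ \ C₁) → ℝ)),
      M.BlockIdentifies (C₁ ∩ C₂) (fun x => a (encodePair k₁ k₂ g₁ g₂ x)) →
      M.BlockIdentifies (C₁ \ C₂) (fun x => b (encodePair k₁ k₂ g₁ g₂ x)) →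
      M.BlockIdentifies (C₂ \ C₁) (fun x => c (encodePair k₁ k₂ g₁ g₂ x)) →
      M.BlockIdentifies (C₁ ∪ C₂)
        (fun x => concat₃ (a (encodePair k₁ k₂ g₁ g₂ x)) (b (encodePair k₁ k₂ g₁ g₂ x))
          (c (encodePair k₁ k₂ g₁ g₂ x))) ∧
      ∀ (K' : ℕ) (d' : Fin K' → ℕ) (M' : MultiViewModel N K' d') (l₁ l₂ : Fin K')
        (g₁' : (Fin (d' l₁) → ℝ) → (C₁ → ℝ)) (g₂' : (Fin (d' l₂) → ℝ) → (C₂ → ℝ)),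
        M'.BlockIdentifiesOnto C₁ W₁ (fun x => g₁' (x l₁)) →
        M'.BlockIdentifiesOnto C₂ W₂ (fun x => g₂' (x l₂)) →
        M'.PartsIndependent C₁ C₂ →
        M'.law.map (fun z => encodePair l₁ l₂ g₁' g₂' (M'.views z)) =
          M.law.map (fun z => encodePair k₁ k₂ g₁ g₂ (M.views z)) →
        M'.BlockIdentifies (C₁ ∩ C₂) (fun x => a (encodePair l₁ l₂ g₁' g₂' x)) ∧
        M'.BlockIdentifies (C₁ ∪ C₂)
          (fun x => concat₃ (a (encodePair l₁ l₂ g₁' g₂' x)) (b (encodePair l₁ l₂ g₁' g₂' x))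
            (c (encodePair l₁ l₂ g₁' g₂' x)))) := by
  constructor
  · obtain ⟨h₁, ⟨-, hm₁, e₁, he₁, -, hl₁, -⟩, hz₁⟩ := hg₁
    obtain ⟨h₂, ⟨-, hm₂, e₂, he₂, -, hl₂, -⟩, hz₂⟩ := hg₂
    have hs₁ : ContDiffOn ℝ ∞ (fun w : (C₁ → ℝ) × (C₂ → ℝ) => e₁ w.1) (W₁ ×ˢ W₂) :=
      he₁.comp contDiff_fst.contDiffOn fun _ hw => hw.1
    have hs₂ : ContDiffOn ℝ ∞ (fun w : (C₁ → ℝ) × (C₂ → ℝ) => e₂ w.2) (W₁ ×ˢ W₂) :=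
      he₂.comp contDiff_snd.contDiffOn fun _ hw => hw.2
    have hv₁ : ∀ z ∈ M.latent, e₁ (g₁ (M.views z k₁)) = subvec C₁ z := fun z hz =>
      (congrArg e₁ (hz₁ z hz)).trans (hl₁ (M.subvec_mem_latentBlock hz C₁))
    have hv₂ : ∀ z ∈ M.latent, e₂ (g₂ (M.views z k₂)) = subvec C₂ z := fun z hz =>
      (congrArg e₂ (hz₂ z hz)).trans (hl₂ (M.subvec_mem_latentBlock hz C₂))
    refine ⟨fun w => Finset.restrict₂ (π := fun _ => ℝ) Finset.inter_subset_left (e₁ w.1),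
      fun w => Finset.restrict₂ (π := fun _ => ℝ) Finset.sdiff_subset (e₁ w.1),
      fun w => Finset.restrict₂ (π := fun _ => ℝ) Finset.sdiff_subset (e₂ w.2),
      (contDiff_restrict₂ _).comp_contDiffOn hs₁, (contDiff_restrict₂ _).comp_contDiffOn hs₁,
      (contDiff_restrict₂ _).comp_contDiffOn hs₂,
      -- The latent coordinates are recovered exactly, so every identifying diffeomorphism is the
      -- identity.
      ⟨_, IsDiffeoOnto.refl _, fun z hz => ?_⟩, ⟨_, IsDiffeoOnto.refl _, fun z hz => ?_⟩,
      ⟨_, IsDiffeoOnto.refl _, fun z hz => ?_⟩, ⟨_, IsDiffeoOnto.refl _, fun z hz => ?_⟩⟩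
    · simp only [encodePair, hv₁ z hz]
      rfl
    · simp only [encodePair, hv₁ z hz]
      rfl
    · simp only [encodePair, hv₂ z hz]
      rfl
    · simp only [encodePair, hv₁ z hz, hv₂ z hz]
      exact concat₃_restrict₂ (subvec (C₁ ∪ C₂) z)
  · intro a b c ha hb hc
    -- The claim within one model is the transfer from the model to itself.
    exact ⟨(MultiViewModel.blockIdentifies_inter_and_union_of_map_law_eq hg₁ hg₂ hg₁ hg₂ rfl
        ha hb hc).2,
      fun _ _ _ _ _ _ _ hg₁' hg₂' _ hlaw =>
        MultiViewModel.blockIdentifies_inter_and_union_of_map_law_eq hg₁ hg₂ hg₁' hg₂' hlaw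
          ha hb hc⟩
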